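/- Let $d\in\mathbb N$, let $\mathcal I$ be a finite set of labels with a target label $\eta_0\in\mathcal I$, and let $p_0=\sum_{\eta\in\mathcal I}w_\eta p_\eta$ be a mixture on $\mathbb R^d$, where $w_\eta\ge 0$, $\sum_\eta w_\eta=1$, and each $p_\eta$ is a probability density supported on a compact convex set $K_\eta\subset\mathbb R^d$. Assume that every $K_\eta$ has an interior point, that $K_\eta\cap K_{\eta'}=\emptyset$ for $\eta\ne\eta'$, that $w_{\eta_0}>0$, and that $\inf_{x\in K_{\eta_0}}p_{\eta_0}(x)>0$. For $t>0$ put $\lambda_t=e^{-t}$, $\sigma_t=\sqrt{1-\lambda_t^2}$, $\phi_t(z)=(\sqrt{2\pi}\,\sigma_t)^{-d}\exp(-\|z\|^2/(2\sigma_t^2))$, and $$p_t(x)=\int p_0(u)\,\phi_t(x-\lambda_t u)\,du,\qquad p_t(\eta_0\mid x)=\frac{w_{\eta_0}\int p_{\eta_0}(u)\,\phi_t(x-\lambda_t u)\,du}{p_t(x)},$$ that is, $p_t$ is the density of $y_t=\lambda_t y_0+\sigma_t w$ with $y_0\sim p_0$ and $w\sim\mathcal N(0,I_d)$ independent, and $p_t(\eta_0\mid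 x)$ is the conditional probability of the label $\eta_0$ given $y_t=x$. Let $T>0$ and $\gamma\ge 1$. Then there exists $\kappa_0>0$, depending only on $T$, $\gamma$ and the mixture data $(w_\eta,p_\eta,K_\eta)_{\eta\in\mathcal I}$ and $\eta_0$, such that for every $\kappa\in(0,1)$ with $\kappa\le\kappa_0$ the following holds. Let $0=t_0<t_1<t_2<\cdots<T$ be any sequence with $t_k\to T$ whose steps $\Delta_k=t_{k+1}-t_k$ satisfy $\Delta_k\le\kappa\min\{1,T-t_{k+1}\}$ for all $k$, let $\hat x_{t_0}\in\mathbb R^d$ be arbitrary, let $Z_0,Z_1,\dots$ be i.i.d. $\mathcal N(0,I_d)$ random vectors, and define for $k\ge 0$ $$\hat x_{t_{k+1}}=e^{\Delta_k}\hat x_{t_k}+2\,(e^{\Delta_k}-1)\bigl(\nabla\log p_{T-t_k}(\hat x_{t_k})+\gamma\,\nabla\log p_{T-t_k}(\eta_0\mid\hat x_{t_k})\bigr)+\sqrt{e^{2\Delta_k}-1}\;Z_k,$$ with gradients in $x$. Then, almost surely, $$\lim_{k\to\infty}\operatorname{dist}(\hat x_{t_k},K_{\eta_0})=0.$$ -/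

import Mathlib

open MeasureTheory ProbabilityTheory Filter Topology
open scoped BigOperators

noncomputable section

namespace GuidedDiffusion

/-- The data of a finite mixture in `ℝ^d`, with labels in `I`: mixture weights `w η`, component
densities `p η` (with respect to Lebesgue measure) and sets `K η` that carry the components. -/
structure MixtureData (d : ℕ) (I : Type*) where
  /-- the mixture weights -/
  w : I → ℝ
  /-- the component densities -/
  p : I → EuclideanSpace ℝ (Fin d) → ℝ
  /-- the sets on which the components are supported -/
  K : I → Set (EuclideanSpace ℝ (Fin d))

variable {d : ℕ} {I : Type*} [Fintype I]

/-- The standing assumption on the mixture, with target label `η₀`. -/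
structure MixtureData.IsAdmissible (M : MixtureData d I) (η₀ : I) : Prop where
  w_nonneg : ∀ η, 0 ≤ M.w η
  sum_w : ∑ η, M.w η = 1
  p_measurable : ∀ η, Measurable (M.p η)
  p_nonneg : ∀ η x, 0 ≤ M.p η x
  integral_p : ∀ η, ∫ x, M.p η x = 1
  p_support : ∀ η, ∀ x ∉ M.K η, M.p η x = 0
  K_convex : ∀ η, Convex ℝ (M.K η)
  K_compact : ∀ η, IsCompact (M.K η)
  K_interior : ∀ η, (interior (M.K η)).Nonempty
  K_disjoint : ∀ η η', η ≠ η' → M.K η ∩ M.K η' = ∅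
  w_target_pos : 0 < M.w η₀
  p_target_lower : ∃ c : ℝ, 0 < c ∧ ∀ x ∈ M.K η₀, c ≤ M.p η₀ x

/-- `λ_t = e^{-t}`. -/
def lam (t : ℝ) : ℝ := Real.exp (-t)

/-- `σ_t = √(1 - λ_t²)`. -/
def sig (t : ℝ) : ℝ := Real.sqrt (1 - lam t ^ 2)

/-- The density `φ_t` of the centred Gaussian law on `ℝ^d` with covariance `σ_t² I_d`. -/
def phi (t : ℝ) (z : EuclideanSpace ℝ (Fin d)) : ℝ :=
  1 / (Real.sqrt (2 * Real.pi) * sig t) ^ d * Real.exp (-(1 / (2 * sig t ^ 2)) * ‖z‖ ^ 2)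

/-- The mixture density `p₀ = ∑ η, w_η p_η`. -/
def MixtureData.p0 (M : MixtureData d I) (x : EuclideanSpace ℝ (Fin d)) : ℝ :=
  ∑ η, M.w η * M.p η x

/-- For `t > 0`: the density `p_t` of `y_t = λ_t y_0 + σ_t w`, where `y_0 ∼ p₀` and `w` is an
independent standard Gaussian vector. -/
def MixtureData.marginal (M : MixtureData d I) (t : ℝ) (x : EuclideanSpace ℝ (Fin d)) : ℝ :=
  ∫ x₀, M.p0 x₀ * phi t (x - lam t • x₀)

/-- For `t > 0`: the joint density `p_t(x, η)` of `y_t` and of the label. -/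
def MixtureData.joint (M : MixtureData d I) (t : ℝ) (η : I) (x : EuclideanSpace ℝ (Fin d)) : ℝ :=
  M.w η * ∫ x₀, M.p η x₀ * phi t (x - lam t • x₀)

/-- For `t > 0`: the conditional probability `p_t(η ∣ x)` of the label `η` given `y_t = x`. -/
def MixtureData.posterior (M : MixtureData d I) (t : ℝ) (η : I)
    (x : EuclideanSpace ℝ (Fin d)) : ℝ :=
  M.joint t η x / M.marginal t x

/-- The guided score `∇ log p_t(x) + γ ∇ log p_t(η₀ ∣ x)`. -/
def MixtureData.guidedScore (M : MixtureData d I) (η₀ : I) (γ t : ℝ)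
    (x : EuclideanSpace ℝ (Fin d)) : EuclideanSpace ℝ (Fin d) :=
  gradient (fun y => Real.log (M.marginal t y)) x
    + γ • gradient (fun y => Real.log (M.posterior t η₀ y)) x

/-- The exponential-integrator iterates `x̂_{t_k}` of guided DDPM with time grid `t`, initial point
`x₀` and Gaussian increments `z k`. -/
def MixtureData.ddpm (M : MixtureData d I) (η₀ : I) (γ T : ℝ) (t : ℕ → ℝ)
    (x₀ : EuclideanSpace ℝ (Fin d)) (z : ℕ → EuclideanSpace ℝ (Fin d)) :
    ℕ → EuclideanSpace ℝ (Fin d)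
  | 0 => x₀
  | k + 1 =>
    Real.exp (t (k + 1) - t k) • M.ddpm η₀ γ T t x₀ z k
      + (2 * (Real.exp (t (k + 1) - t k) - 1)) •
          M.guidedScore η₀ γ (T - t k) (M.ddpm η₀ γ T t x₀ z k)
      + Real.sqrt (Real.exp (2 * (t (k + 1) - t k)) - 1) • z k

/-- `t` is an infinite time grid `0 = t_0 < t_1 < ⋯ < T` with `t_k → T`. -/
structure IsTimeGrid (T : ℝ) (t : ℕ → ℝ) : Prop where
  zero : t 0 = 0
  lt_succ : ∀ k, t k < t (k + 1)
  lt_end : ∀ k, t k < T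
  tendsto : Tendsto t atTop (𝓝 T)

/-- The step-size condition `t_{k+1} - t_k ≤ κ min {1, T - t_{k+1}}`. -/
def StepSizeBound (κ T : ℝ) (t : ℕ → ℝ) : Prop :=
  ∀ k, t (k + 1) - t k ≤ κ * min 1 (T - t (k + 1))

end GuidedDiffusion

end

/-! By Tweedie's formula, `∇ log` of a noised density at `x` is `σ⁻² (λ m - x)`, where `m` is the
posterior mean of the clean point. Write `m₀` for the posterior mean under the target component and
`m` for the one under the whole mixture. A step of the scheme then reads `x ↦ x + h (m₀ + (γ - 1)(m₀
- m) - x + e) + noise`, with `h = 2 (e^Δ - 1) / σ²` and an error `e` that is negligible as the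
remaining time `s = T - t_k` tends to `0`.

The noise variances are summable, so almost surely the noise series converges
(`ae_exists_tendsto_sum_smul_stdGaussian`). Adding the tail of that series to `x` gives a sequence
`y` with a noiseless recursion and `y - x → 0`; the rest is deterministic.

The Lyapunov function is the squared distance from `y` to the target set `K`. Let `q` be the
projection of `y` and `v = y - q`. By convexity `⟨m₀ - q, v⟩ ≤ 0`, so the pull to `m₀` contracts.
The guidance term is harmless: the mixture density is bounded below on `K`, so for small `s` the
posterior concentrates on points hardly farther from `x` than `K` is, uniformly in `x`
(`IsBoundedDensity.eventually_norm_sub_postMean_le`). Hence `‖x - m‖` is at most about `‖v‖`, and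
`⟨m₀ - m, v⟩ ≤ -‖v‖² + ⟨x - m, v⟩ + small` has no significant positive part. The term quadratic in
`h` is absorbed when `κ` is small relative to `γ` (`norm_sq_step_le`).

This yields a contraction by `1 - h ≤ s_{k+1} / s_k` up to a vanishing relative error. The ratios
telescope and `s_k → 0`, so the distance vanishes (`tendsto_zero_of_recursion`). -/

namespace GuidedDiffusion

/-! ### Noised densities, posterior means and Tweedie's formula. -/

section Heat

variable {d : ℕ}

/-- A nonnegative integrable function that vanishes outside the ball of radius `R`. -/
structure IsBoundedDensity (p : EuclideanSpace ℝ (Fin d) → ℝ) (R : ℝ) : Prop where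
  nonneg : ∀ x, 0 ≤ p x
  integrable : Integrable p
  support : ∀ x, R < ‖x‖ → p x = 0

/-- The density `p` pushed through the noising kernel at time `t`. -/
noncomputable def heat (p : EuclideanSpace ℝ (Fin d) → ℝ) (t : ℝ)
    (x : EuclideanSpace ℝ (Fin d)) : ℝ :=
  ∫ u, p u * phi t (x - lam t • u)

/-- The unnormalized first moment of the clean point given the noised point `x`. -/
noncomputable def heatMoment (p : EuclideanSpace ℝ (Fin d) → ℝ) (t : ℝ)
    (x : EuclideanSpace ℝ (Fin d)) : EuclideanSpace ℝ (Fin d) :=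
  ∫ u, (p u * phi t (x - lam t • u)) • u

/-- The posterior mean of the clean point given the noised point `x`. -/
noncomputable def postMean (p : EuclideanSpace ℝ (Fin d) → ℝ) (t : ℝ)
    (x : EuclideanSpace ℝ (Fin d)) : EuclideanSpace ℝ (Fin d) :=
  (heat p t x)⁻¹ • heatMoment p t x

theorem lam_pos (t : ℝ) : 0 < lam t := Real.exp_pos _

theorem lam_le_one {t : ℝ} (ht : 0 < t) : lam t ≤ 1 := by
  rw [lam, Real.exp_le_one_iff]; linarith

theorem sig_sq {t : ℝ} (ht : 0 < t) : sig t ^ 2 = 1 - lam t ^ 2 := by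
  rw [sig, Real.sq_sqrt]
  nlinarith [lam_pos t, lam_le_one ht]

theorem sig_pos {t : ℝ} (ht : 0 < t) : 0 < sig t := by
  have h : lam t < 1 := by rw [lam, Real.exp_lt_one_iff]; linarith
  refine Real.sqrt_pos.2 ?_
  nlinarith [lam_pos t]

/-- The normalizing constant of the noising kernel. -/
noncomputable def phiConst (d : ℕ) (t : ℝ) : ℝ := 1 / (Real.sqrt (2 * Real.pi) * sig t) ^ d

theorem phiConst_pos {t : ℝ} (ht : 0 < t) : 0 < phiConst d t := by
  have := sig_pos ht
  unfold phiConst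
  positivity

theorem phi_eq (t : ℝ) (z : EuclideanSpace ℝ (Fin d)) :
    phi t z = phiConst d t * Real.exp (-(1 / (2 * sig t ^ 2)) * ‖z‖ ^ 2) := rfl

theorem phi_nonneg {t : ℝ} (ht : 0 < t) (z : EuclideanSpace ℝ (Fin d)) : 0 ≤ phi t z := by
  rw [phi_eq]
  have := phiConst_pos (d := d) ht
  positivity

theorem continuous_phi (t : ℝ) : Continuous (phi (d := d) t) := by
  unfold phi
  fun_prop

theorem phi_le_of_le_norm {t a : ℝ} (ht : 0 < t) (ha : 0 ≤ a) {z : EuclideanSpace ℝ (Fin d)}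
    (h : a ≤ ‖z‖) :
    phi t z ≤ phiConst d t * Real.exp (-(1 / (2 * sig t ^ 2)) * a ^ 2) := by
  rw [phi_eq]
  have := phiConst_pos (d := d) ht
  have : 0 ≤ 1 / (2 * sig t ^ 2) := by positivity
  refine mul_le_mul_of_nonneg_left (Real.exp_le_exp.2 ?_) (by positivity)
  rw [neg_mul, neg_mul, neg_le_neg_iff]
  gcongr

theorem le_phi_of_norm_le {t a : ℝ} (ht : 0 < t) {z : EuclideanSpace ℝ (Fin d)}
    (h : ‖z‖ ≤ a) :
    phiConst d t * Real.exp (-(1 / (2 * sig t ^ 2)) * a ^ 2) ≤ phi t z := by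
  rw [phi_eq]
  have := phiConst_pos (d := d) ht
  have : 0 ≤ 1 / (2 * sig t ^ 2) := by positivity
  refine mul_le_mul_of_nonneg_left (Real.exp_le_exp.2 ?_) (by positivity)
  rw [neg_mul, neg_mul, neg_le_neg_iff]
  gcongr

theorem phi_le_phiConst {t : ℝ} (ht : 0 < t) (z : EuclideanSpace ℝ (Fin d)) :
    phi t z ≤ phiConst d t := by
  simpa using phi_le_of_le_norm ht le_rfl (norm_nonneg z)

theorem hasFDerivAt_phi (t : ℝ) (z : EuclideanSpace ℝ (Fin d)) :
    HasFDerivAt (phi t) (-((sig t ^ 2)⁻¹ * phi t z) • innerSL ℝ z) z := by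
  have h1 : HasFDerivAt (fun y : EuclideanSpace ℝ (Fin d) => ‖y‖ ^ 2) (2 • innerSL ℝ z) z :=
    (hasStrictFDerivAt_norm_sq z).hasFDerivAt
  have h2 := ((h1.const_mul (-(1 / (2 * sig t ^ 2)))).exp).const_mul (phiConst d t)
  refine h2.congr_fderiv ?_
  ext v
  rw [phi_eq]
  simp
  ring

theorem IsBoundedDensity.integrable_smul {p : EuclideanSpace ℝ (Fin d) → ℝ} {R : ℝ}
    (hp : IsBoundedDensity p R) {F : Type*} [NormedAddCommGroup F] [NormedSpace ℝ F]
    {f : EuclideanSpace ℝ (Fin d) → F} (hf : Continuous f) :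
    Integrable (fun u => p u • f u) := by
  obtain ⟨C, hC⟩ := (isCompact_closedBall (0 : EuclideanSpace ℝ (Fin d))
    R).exists_bound_of_continuousOn hf.continuousOn
  refine (hp.integrable.norm.const_mul C).mono'
    (hp.integrable.aestronglyMeasurable.smul hf.aestronglyMeasurable) (ae_of_all _ fun u => ?_)
  rw [norm_smul, mul_comm]
  by_cases hu : R < ‖u‖
  · simp [hp.support u hu]
  · exact mul_le_mul_of_nonneg_right (hC u (by simpa using hu)) (norm_nonneg _)

variable {p : EuclideanSpace ℝ (Fin d) → ℝ} {R : ℝ}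

theorem continuous_phi_comp (t : ℝ) (x : EuclideanSpace ℝ (Fin d)) :
    Continuous fun u : EuclideanSpace ℝ (Fin d) => phi t (x - lam t • u) :=
  (continuous_phi t).comp (by fun_prop)

theorem IsBoundedDensity.integrable_mul_phi (hp : IsBoundedDensity p R) (t : ℝ)
    (x : EuclideanSpace ℝ (Fin d)) : Integrable fun u => p u * phi t (x - lam t • u) :=
  hp.integrable_smul (continuous_phi_comp t x)

theorem IsBoundedDensity.integrable_mul_phi_smul (hp : IsBoundedDensity p R) {F : Type*}
    [NormedAddCommGroup F] [NormedSpace ℝ F] {f : EuclideanSpace ℝ (Fin d) → F}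
    (hf : Continuous f) (t : ℝ) (x : EuclideanSpace ℝ (Fin d)) :
    Integrable fun u => (p u * phi t (x - lam t • u)) • f u := by
  simp_rw [mul_smul]
  exact hp.integrable_smul ((continuous_phi_comp t x).smul hf)

theorem IsBoundedDensity.integrable_moment (hp : IsBoundedDensity p R) (t : ℝ)
    (x : EuclideanSpace ℝ (Fin d)) : Integrable fun u => (p u * phi t (x - lam t • u)) • u :=
  hp.integrable_mul_phi_smul continuous_id t x

/-- Differentiation under the integral: for `y` in the unit ball around `x` the kernel gradient is
bounded uniformly over the support of `p`, so a multiple of `p` dominates. -/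
theorem IsBoundedDensity.hasGradientAt_heat (hp : IsBoundedDensity p R) {t : ℝ} (ht : 0 < t)
    (x : EuclideanSpace ℝ (Fin d)) :
    HasGradientAt (heat p t)
      ((sig t ^ 2)⁻¹ • (lam t • heatMoment p t x - heat p t x • x)) x := by
  let G : EuclideanSpace ℝ (Fin d) → EuclideanSpace ℝ (Fin d) → EuclideanSpace ℝ (Fin d) :=
    fun y u => (sig t ^ 2)⁻¹ • (p u * phi t (y - lam t • u)) • (lam t • u - y)
  have hGint : ∀ y, Integrable (G y) := fun y =>
    (hp.integrable_mul_phi_smul (f := fun u => lam t • u - y) (by fun_prop) t y).smul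
      (sig t ^ 2)⁻¹
  have key : HasFDerivAt (fun y => ∫ u, p u * phi t (y - lam t • u))
      (∫ u, innerSL ℝ (G x u)) x := by
    refine hasFDerivAt_integral_of_dominated_of_fderiv_le (F' := fun y u => innerSL ℝ (G y u))
      (bound := fun u => p u * ((sig t ^ 2)⁻¹ * phiConst d t * (lam t * R + (‖x‖ + 1))))
      (Metric.ball_mem_nhds x one_pos)
      (Eventually.of_forall fun y => (hp.integrable_mul_phi t y).aestronglyMeasurable)
      (hp.integrable_mul_phi t x) ?_ ?_ ?_ ?_
    · exact (innerSL ℝ).continuous.comp_aestronglyMeasurable (hGint x).aestronglyMeasurable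
    · refine ae_of_all _ fun u y hy => ?_
      rw [innerSL_apply_norm]
      by_cases hu : R < ‖u‖
      · simp [G, hp.support u hu]
      · have h1 : ‖lam t • u - y‖ ≤ lam t * R + (‖x‖ + 1) := by
          refine (norm_sub_le _ _).trans (add_le_add ?_ ?_)
          · rw [norm_smul, Real.norm_of_nonneg (lam_pos t).le]
            exact mul_le_mul_of_nonneg_left (not_lt.1 hu) (lam_pos t).le
          · have : ‖y - x‖ < 1 := by simpa [dist_eq_norm] using hy
            have := norm_le_norm_add_norm_sub x y
            rw [norm_sub_rev] at this
            linarith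
        have h2 := phi_le_phiConst ht (y - lam t • u)
        have h3 := phi_nonneg ht (y - lam t • u)
        have h4 := hp.nonneg u
        have h5 : 0 ≤ (sig t ^ 2)⁻¹ := by positivity
        simp only [G, norm_smul, norm_mul, Real.norm_of_nonneg h3, Real.norm_of_nonneg h4,
          Real.norm_of_nonneg h5]
        calc (sig t ^ 2)⁻¹ * (p u * phi t (y - lam t • u) * ‖lam t • u - y‖)
            ≤ (sig t ^ 2)⁻¹ * (p u * phiConst d t * (lam t * R + (‖x‖ + 1))) := by
              have := phiConst_pos (d := d) ht
              gcongr
          _ = _ := by ring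
    · exact hp.integrable.mul_const _
    · refine ae_of_all _ fun u y _ => ?_
      have h1 : HasFDerivAt (fun y : EuclideanSpace ℝ (Fin d) => y - lam t • u)
          (ContinuousLinearMap.id ℝ _) y := (hasFDerivAt_id y).sub_const _
      have h2 := ((hasFDerivAt_phi t (y - lam t • u)).comp y h1).const_mul (p u)
      refine h2.congr_fderiv ?_
      ext v
      simp [G]
      ring
  rw [hasGradientAt_iff_hasFDerivAt]
  refine key.congr_fderiv ?_
  ext v
  have hint : Integrable fun u => innerSL ℝ (G x u) :=
    (innerSL ℝ (E := EuclideanSpace ℝ (Fin d))).integrable_comp (hGint x)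
  rw [ContinuousLinearMap.integral_apply hint]
  simp only [innerSL_apply_apply, InnerProductSpace.toDual_apply_apply]
  simp_rw [real_inner_comm v]
  rw [integral_inner (hGint x)]
  congr 1
  simp only [G]
  rw [integral_smul]
  congr 1
  simp_rw [smul_sub]
  rw [integral_sub, heatMoment, heat, integral_smul_const, ← integral_smul]
  · simp_rw [smul_comm (lam t)]
  · exact hp.integrable_mul_phi_smul (by fun_prop) t x
  · exact hp.integrable_mul_phi_smul (by fun_prop) t x

/-- Tweedie's formula, from dividing the gradient of `heat` by its value. -/
theorem IsBoundedDensity.gradient_log_heat (hp : IsBoundedDensity p R) {t : ℝ} (ht : 0 < t)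
    {x : EuclideanSpace ℝ (Fin d)} (hpos : 0 < heat p t x) :
    HasGradientAt (fun y => Real.log (heat p t y))
      ((sig t ^ 2)⁻¹ • (lam t • postMean p t x - x)) x := by
  have h := (hp.hasGradientAt_heat ht x).hasFDerivAt.log hpos.ne'
  rw [hasGradientAt_iff_hasFDerivAt]
  refine h.congr_fderiv ?_
  rw [← map_smul, postMean]
  congr 1
  rw [smul_comm, smul_sub, smul_comm, smul_smul _ _ x, inv_mul_cancel₀ hpos.ne', one_smul]

theorem IsBoundedDensity.mul_le_heat (hp : IsBoundedDensity p R) {t : ℝ} (ht : 0 < t)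
    {b x : EuclideanSpace ℝ (Fin d)} {r c a : ℝ}
    (hb : ∀ u ∈ Metric.ball b r, c ≤ p u)
    (ha : ∀ u ∈ Metric.ball b r, ‖x - lam t • u‖ ≤ a) :
    c * (phiConst d t * Real.exp (-(1 / (2 * sig t ^ 2)) * a ^ 2)) *
      volume.real (Metric.ball (0 : EuclideanSpace ℝ (Fin d)) r) ≤ heat p t x := by
  have hint := hp.integrable_mul_phi t x
  have h0 : ∀ u, 0 ≤ p u * phi t (x - lam t • u) := fun u =>
    mul_nonneg (hp.nonneg u) (phi_nonneg ht _)
  calc _ = ∫ _ in Metric.ball b r,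
        c * (phiConst d t * Real.exp (-(1 / (2 * sig t ^ 2)) * a ^ 2)) := by
        rw [setIntegral_const, Measure.addHaar_real_ball_center volume b, smul_eq_mul, mul_comm]
    _ ≤ ∫ u in Metric.ball b r, p u * phi t (x - lam t • u) := by
        refine setIntegral_mono_on (integrableOn_const measure_ball_lt_top.ne) hint.integrableOn
          measurableSet_ball fun u hu => ?_
        have := phiConst_pos (d := d) ht
        exact mul_le_mul (hb u hu) (le_phi_of_norm_le ht (ha u hu)) (by positivity)
          (hp.nonneg u)
    _ ≤ heat p t x := setIntegral_le_integral hint (ae_of_all _ h0)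

theorem IsBoundedDensity.heat_pos (hp : IsBoundedDensity p R) {t : ℝ} (ht : 0 < t)
    {K : Set (EuclideanSpace ℝ (Fin d))} (hK : (interior K).Nonempty) {c : ℝ} (hc : 0 < c)
    (hKp : ∀ u ∈ K, c ≤ p u) (x : EuclideanSpace ℝ (Fin d)) : 0 < heat p t x := by
  obtain ⟨b, hb⟩ := hK
  obtain ⟨r, hr, hbr⟩ := Metric.isOpen_iff.1 isOpen_interior b hb
  have hv : 0 < volume.real (Metric.ball (0 : EuclideanSpace ℝ (Fin d)) r) :=
    ENNReal.toReal_pos (Metric.measure_ball_pos _ _ hr).ne' measure_ball_lt_top.ne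
  refine lt_of_lt_of_le ?_ (hp.mul_le_heat ht (b := b) (r := r) (a := ‖x‖ + lam t * (‖b‖ + r))
    (fun u hu => hKp u (interior_subset (hbr hu))) fun u hu => ?_)
  · have := phiConst_pos (d := d) ht
    positivity
  · refine (norm_sub_le _ _).trans (add_le_add le_rfl ?_)
    rw [norm_smul, Real.norm_of_nonneg (lam_pos t).le]
    have : ‖u - b‖ < r := by simpa [dist_eq_norm] using hu
    have := norm_le_norm_add_norm_sub b u
    rw [norm_sub_rev] at this
    exact mul_le_mul_of_nonneg_left (by linarith) (lam_pos t).le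

/-- An average of points of a half-space stays in it. This is applied to the half-space that
supports the target set at a projection. -/
theorem IsBoundedDensity.inner_postMean_le (hp : IsBoundedDensity p R) {t : ℝ} (ht : 0 < t)
    {x v : EuclideanSpace ℝ (Fin d)} (hpos : 0 < heat p t x) {b : ℝ}
    (hb : ∀ u, p u ≠ 0 → inner ℝ u v ≤ b) : inner ℝ (postMean p t x) v ≤ b := by
  have h1 : inner ℝ (heatMoment p t x) v ≤ b * heat p t x := by
    rw [real_inner_comm, heatMoment,
      ← integral_inner (hp.integrable_moment t x), heat, ← integral_const_mul]
    refine integral_mono ?_ ((hp.integrable_mul_phi t x).const_mul b) fun u => ?_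
    · exact (hp.integrable_moment t x).const_inner v
    · simp only [inner_smul_right, real_inner_comm u v]
      rcases eq_or_ne (p u) 0 with h | h
      · simp [h]
      · rw [mul_comm b]
        exact mul_le_mul_of_nonneg_left (hb u h) (mul_nonneg (hp.nonneg u) (phi_nonneg ht _))
  rw [postMean, inner_smul_left]
  simp only [conj_trivial]
  rw [inv_mul_le_iff₀ hpos, mul_comm]
  exact h1

/-- The distance from `z` to the posterior mean is at most the mean distance to `z` under the
posterior. -/
theorem IsBoundedDensity.norm_sub_postMean_le (hp : IsBoundedDensity p R) {t : ℝ} (ht : 0 < t)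
    {x : EuclideanSpace ℝ (Fin d)} (hpos : 0 < heat p t x) {b : ℝ} (z : EuclideanSpace ℝ (Fin d))
    (hb : ∫ u, p u * phi t (x - lam t • u) * ‖z - u‖ ≤ b * heat p t x) :
    ‖z - postMean p t x‖ ≤ b := by
  have h1 : z - postMean p t x
      = (heat p t x)⁻¹ • ∫ u, (p u * phi t (x - lam t • u)) • (z - u) := by
    simp_rw [smul_sub]
    rw [integral_sub (hp.integrable_mul_phi_smul continuous_const t x)
      (hp.integrable_moment t x), integral_smul_const, smul_sub, smul_smul]
    change _ = ((heat p t x)⁻¹ * heat p t x) • z - (heat p t x)⁻¹ • heatMoment p t x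
    rw [inv_mul_cancel₀ hpos.ne', one_smul, postMean]
  rw [h1, norm_smul, Real.norm_of_nonneg (inv_nonneg.2 hpos.le), inv_mul_le_iff₀ hpos, mul_comm]
  refine (norm_integral_le_integral_norm _).trans (le_of_eq_of_le ?_ hb)
  refine integral_congr_ae (ae_of_all _ fun u => ?_)
  simp only [norm_smul]
  rw [Real.norm_of_nonneg (mul_nonneg (hp.nonneg u) (phi_nonneg ht _))]

theorem IsBoundedDensity.norm_postMean_le (hp : IsBoundedDensity p R) {t : ℝ} (ht : 0 < t)
    {x : EuclideanSpace ℝ (Fin d)} (hpos : 0 < heat p t x) : ‖postMean p t x‖ ≤ R := by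
  have := hp.norm_sub_postMean_le ht hpos (b := R) 0 ?_
  · simpa using this
  rw [heat, ← integral_const_mul]
  refine integral_mono (hp.integrable_mul_phi_smul (f := fun u => ‖0 - u‖) (by fun_prop) t x)
    ((hp.integrable_mul_phi t x).const_mul R) fun u => ?_
  by_cases hu : R < ‖u‖
  · simp [hp.support u hu]
  · simp only [zero_sub, norm_neg]
    rw [mul_comm]
    exact mul_le_mul_of_nonneg_right (not_lt.1 hu) (mul_nonneg (hp.nonneg u) (phi_nonneg ht _))

end Heat

/-! ### Concentration of the posterior as the noise vanishes. -/

section Concentration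

variable {d : ℕ} {p : EuclideanSpace ℝ (Fin d) → ℝ} {R : ℝ}

theorem tendsto_lam : Tendsto lam (𝓝[>] 0) (𝓝 1) := by
  have : ContinuousAt lam 0 := by unfold lam; fun_prop
  have h := this.tendsto.mono_left (nhdsWithin_le_nhds (s := Set.Ioi 0))
  simpa [lam] using h

theorem tendsto_sig_sq : Tendsto (fun t => sig t ^ 2) (𝓝[>] 0) (𝓝[>] 0) := by
  refine tendsto_nhdsWithin_iff.2 ⟨?_, ?_⟩
  · have h : Tendsto (fun t => 1 - lam t ^ 2) (𝓝[>] 0) (𝓝 (1 - 1 ^ 2)) :=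
      (tendsto_lam.pow 2).const_sub 1
    rw [one_pow, sub_self] at h
    refine h.congr' ?_
    filter_upwards [self_mem_nhdsWithin] with t ht using (sig_sq ht).symm
  · filter_upwards [self_mem_nhdsWithin] with t ht
    have := sig_pos ht
    exact Set.mem_Ioi.2 (by positivity)

theorem tendsto_exp_neg_div_sig_sq {a : ℝ} (ha : 0 < a) :
    Tendsto (fun t => Real.exp (-(a / sig t ^ 2))) (𝓝[>] 0) (𝓝 0) := by
  refine Real.tendsto_exp_neg_atTop_nhds_zero.comp ?_
  simp_rw [div_eq_mul_inv]
  exact (tendsto_inv_nhdsGT_zero.comp tendsto_sig_sq).const_mul_atTop ha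

/-- Near each point `q` of a bounded convex set that contains a ball there is a translate of a
ball, of radius independent of `q`, that lies in the set. -/
theorem exists_ball_subset_of_convex {E : Type*} [NormedAddCommGroup E] [NormedSpace ℝ E]
    {K : Set E} (hK : Convex ℝ K)
    (hKR : ∀ u ∈ K, ‖u‖ ≤ R) (hint : (interior K).Nonempty) {δ : ℝ} (hδ : 0 < δ) :
    ∃ r > 0, ∀ q ∈ K, ∃ b, ∀ u ∈ Metric.ball b r, u ∈ K ∧ ‖q - u‖ ≤ δ := by
  obtain ⟨a, ha⟩ := hint
  obtain ⟨r, hr, har⟩ := Metric.isOpen_iff.1 isOpen_interior a ha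
  have hR : 0 ≤ R := (norm_nonneg a).trans (hKR a (interior_subset ha))
  -- The homothety with centre `q` and ratio `θ` maps the fixed ball around `a` into `K` by
  -- convexity, and `θ * (2 * R) ≤ δ` keeps the image close to `q`.
  set θ : ℝ := δ / (δ + 2 * R) with hθ
  have hθ0 : 0 < θ := by positivity
  have hθ1 : θ ≤ 1 := (div_le_one (by positivity)).2 (by linarith)
  have hθR : θ * (2 * R) ≤ δ := by
    rw [hθ, div_mul_eq_mul_div, div_le_iff₀ (by positivity)]
    nlinarith
  refine ⟨θ * r, by positivity, fun q hq => ⟨q + θ • (a - q), fun u hu => ?_⟩⟩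
  set a' : E := q + θ⁻¹ • (u - q) with ha'
  have hu' : u = (1 - θ) • q + θ • a' := by
    rw [ha', smul_add, smul_smul, mul_inv_cancel₀ hθ0.ne', one_smul, sub_smul, one_smul]
    abel
  have haK : a' ∈ K := by
    refine interior_subset (har ?_)
    have h1 : a' - a = θ⁻¹ • (u - (q + θ • (a - q))) := by
      rw [ha', smul_sub θ⁻¹ u (q + θ • (a - q)), smul_add, smul_smul, inv_mul_cancel₀ hθ0.ne',
        smul_sub, one_smul]
      abel
    rw [Metric.mem_ball, dist_eq_norm, h1, norm_smul, norm_inv, Real.norm_of_nonneg hθ0.le,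
      inv_mul_lt_iff₀ hθ0]
    simpa [dist_eq_norm] using hu
  refine ⟨?_, ?_⟩
  · rw [hu']
    exact hK hq haK (by linarith) hθ0.le (by ring)
  · have h2 : q - u = θ • (q - a') := by
      rw [hu', sub_smul, one_smul, smul_sub]
      abel
    rw [h2, norm_smul, Real.norm_of_nonneg hθ0.le]
    refine le_trans (mul_le_mul_of_nonneg_left ?_ hθ0.le) hθR
    have := norm_sub_le q a'
    have := hKR q hq
    have := hKR a' haK
    linarith

/-- As `t → 0`, the posterior given `x` concentrates on the points that are about as close to `x`
as the set `K` on which the density is bounded below; this is uniform in `x`. -/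
theorem IsBoundedDensity.eventually_norm_sub_postMean_le (hp : IsBoundedDensity p R)
    {K : Set (EuclideanSpace ℝ (Fin d))} (hK : Convex ℝ K) (hKc : IsCompact K)
    (hint : (interior K).Nonempty) {c : ℝ} (hc : 0 < c) (hKp : ∀ u ∈ K, c ≤ p u)
    {ε : ℝ} (hε : 0 < ε) :
    ∀ᶠ t in 𝓝[>] (0 : ℝ), ∀ x, ‖x - postMean p t x‖ ≤ Metric.infDist x K + ε := by
  have hKR : ∀ u ∈ K, ‖u‖ ≤ R := fun u hu => by
    by_contra! h
    linarith [hKp u hu, hp.support u h]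
  have hKne : K.Nonempty := hint.mono interior_subset
  have hR : 0 ≤ R := by
    obtain ⟨u, hu⟩ := hKne
    exact (norm_nonneg u).trans (hKR u hu)
  obtain ⟨r, hr, hball⟩ := exists_ball_subset_of_convex hK hKR hint (δ := ε / 6) (by positivity)
  set V := volume.real (Metric.ball (0 : EuclideanSpace ℝ (Fin d)) r) with hV
  have hVpos : 0 < V :=
    ENNReal.toReal_pos (Metric.measure_ball_pos _ _ hr).ne' measure_ball_lt_top.ne
  set m := ∫ u, p u with hm
  have hm0 : 0 ≤ m := integral_nonneg hp.nonneg
  have hev1 : ∀ᶠ t in 𝓝[>] (0 : ℝ), m * (2 * R) / (c * V) * Real.exp (-(ε ^ 2 / 72 / sig t ^ 2))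
      < ε / 2 := by
    have h := (tendsto_exp_neg_div_sig_sq (a := ε ^ 2 / 72) (by positivity)).const_mul
      (m * (2 * R) / (c * V))
    rw [mul_zero] at h
    exact h.eventually_lt_const (by positivity)
  have hev2 : ∀ᶠ t in 𝓝[>] (0 : ℝ), (1 - lam t) * R < ε / 12 := by
    have h := (tendsto_lam.const_sub 1).mul_const R
    rw [sub_self, zero_mul] at h
    exact h.eventually_lt_const (by positivity)
  filter_upwards [hev1, hev2, self_mem_nhdsWithin] with t h1 h2 (ht : 0 < t) x
  have hpos := hp.heat_pos ht hint hc hKp x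
  have hN := phiConst_pos (d := d) ht
  have hσ := sig_pos ht
  have hl := lam_le_one ht
  set ρ := Metric.infDist x K with hρ
  have hρ0 : 0 ≤ ρ := Metric.infDist_nonneg
  obtain ⟨q, hqK, hq⟩ := hKc.exists_infDist_eq_dist hKne x
  rw [dist_eq_norm, ← hρ] at hq
  have hshift : ∀ u : EuclideanSpace ℝ (Fin d), ‖u‖ ≤ R → ‖(1 - lam t) • u‖ ≤ ε / 12 := by
    intro u hu
    rw [norm_smul, Real.norm_of_nonneg (by linarith)]
    exact (mul_le_mul_of_nonneg_left hu (by linarith)).trans h2.le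
  -- The margins are `ε / 4 = ε / 6 + ε / 12` and `5 * ε / 12 = ε / 2 - ε / 12`: `ε / 6` is the
  -- reach of the small ball near `q`, and `ε / 12` pays for replacing `lam t • u` by `u`.
  set near := phiConst d t * Real.exp (-(1 / (2 * sig t ^ 2)) * (ρ + ε / 4) ^ 2) with hnear
  set far := phiConst d t * Real.exp (-(1 / (2 * sig t ^ 2)) * (ρ + 5 * ε / 12) ^ 2) with hfar
  have hlow : c * near * V ≤ heat p t x := by
    obtain ⟨b, hb⟩ := hball q hqK
    refine hp.mul_le_heat ht (fun u hu => hKp u (hb u hu).1) fun u hu => ?_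
    have e : x - lam t • u = (x - q) + (q - u) + (1 - lam t) • u := by
      rw [sub_smul, one_smul]; abel
    rw [e]
    have := norm_add₃_le (a := x - q) (b := q - u) (c := (1 - lam t) • u)
    have := (hb u hu).2
    have := hshift u (hKR u (hb u hu).1)
    linarith
  -- The squared radii differ by at least `ε ^ 2 / 36` whatever `ρ ≥ 0` is, which makes the estimate
  -- uniform in `x`.
  have hratio : far ≤ near * Real.exp (-(ε ^ 2 / 72 / sig t ^ 2)) := by
    rw [hfar, hnear, mul_assoc, ← Real.exp_add]
    refine mul_le_mul_of_nonneg_left (Real.exp_le_exp.2 ?_) hN.le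
    have e : -(1 / (2 * sig t ^ 2)) * (ρ + ε / 4) ^ 2 + -(ε ^ 2 / 72 / sig t ^ 2)
        = -(1 / (2 * sig t ^ 2)) * ((ρ + ε / 4) ^ 2 + ε ^ 2 / 36) := by
      field_simp
      ring
    rw [e, neg_mul, neg_mul, neg_le_neg_iff]
    refine mul_le_mul_of_nonneg_left ?_ (by positivity)
    nlinarith [mul_nonneg hρ0 hε.le]
  refine hp.norm_sub_postMean_le ht hpos x ?_
  -- A far point exceeds the distance `ρ + ε / 2` by at most `2 * R`, again independently of `x`.
  have hpt : ∀ u, p u * phi t (x - lam t • u) * ‖x - u‖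
      ≤ (ρ + ε / 2) * (p u * phi t (x - lam t • u)) + p u * (2 * R * far) := by
    intro u
    have hpu := hp.nonneg u
    have hphi := phi_nonneg ht (x - lam t • u)
    by_cases hu : R < ‖u‖
    · simp [hp.support u hu]
    rw [not_lt] at hu
    have hfar0 : 0 ≤ far := by positivity
    by_cases hd : ‖x - u‖ ≤ ρ + ε / 2
    · rw [mul_comm (ρ + ε / 2)]
      have : 0 ≤ p u * (2 * R * far) := by positivity
      have := mul_le_mul_of_nonneg_left hd (mul_nonneg hpu hphi)
      linarith
    · rw [not_le] at hd
      have hle : phi t (x - lam t • u) ≤ far := by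
        refine phi_le_of_le_norm ht (by positivity) ?_
        have e : x - u = (x - lam t • u) - (1 - lam t) • u := by
          rw [sub_smul, one_smul]; abel
        have := norm_sub_le (x - lam t • u) ((1 - lam t) • u)
        rw [← e] at this
        have := hshift u hu
        linarith
      have hxu : ‖x - u‖ ≤ ρ + 2 * R := by
        have e : x - u = (x - q) + (q - u) := by abel
        rw [e]
        have := norm_add_le (x - q) (q - u)
        have := norm_sub_le q u
        have := hKR q hqK
        linarith
      calc p u * phi t (x - lam t • u) * ‖x - u‖
          ≤ p u * phi t (x - lam t • u) * (ρ + ε / 2 + 2 * R) :=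
            mul_le_mul_of_nonneg_left (by linarith) (mul_nonneg hpu hphi)
        _ = (ρ + ε / 2) * (p u * phi t (x - lam t • u))
            + p u * (2 * R * phi t (x - lam t • u)) := by ring
        _ ≤ _ := by gcongr
  calc ∫ u, p u * phi t (x - lam t • u) * ‖x - u‖
      ≤ ∫ u, ((ρ + ε / 2) * (p u * phi t (x - lam t • u)) + p u * (2 * R * far)) :=
        integral_mono (hp.integrable_mul_phi_smul (f := fun u => ‖x - u‖) (by fun_prop) t x)
          (((hp.integrable_mul_phi t x).const_mul _).add (hp.integrable.mul_const _)) hpt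
    _ = (ρ + ε / 2) * heat p t x + m * (2 * R * far) := by
        rw [integral_add ((hp.integrable_mul_phi t x).const_mul _) (hp.integrable.mul_const _),
          integral_const_mul, integral_mul_const, heat]
    _ ≤ (ρ + ε / 2) * heat p t x + ε / 2 * heat p t x := by
        refine add_le_add le_rfl ?_
        have hnear0 : 0 < near := by positivity
        calc m * (2 * R * far)
            ≤ m * (2 * R * (near * Real.exp (-(ε ^ 2 / 72 / sig t ^ 2)))) := by gcongr
          _ = m * (2 * R) / (c * V) * Real.exp (-(ε ^ 2 / 72 / sig t ^ 2)) * (c * near * V) := by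
            field_simp
          _ ≤ ε / 2 * heat p t x := by gcongr
    _ = (ρ + ε) * heat p t x := by ring

end Concentration

/-! ### A scalar recursion with telescoping contraction factors. -/

section Recursion

/-- A nonnegative sequence with `V (k + 1) ≤ (1 - h k) V k + h k * η` eventually, for every
`η > 0`, tends to zero if `1 - h k` is dominated by the successive ratios of a positive sequence
that tends to zero. -/
theorem tendsto_zero_of_recursion {V h s : ℕ → ℝ} (hV : ∀ k, 0 ≤ V k) (hs : ∀ k, 0 < s k)
    (hs0 : Tendsto s atTop (𝓝 0))
    (h1 : ∀ᶠ k in atTop, 0 ≤ 1 - h k ∧ 1 - h k ≤ s (k + 1) / s k)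
    (hrec : ∀ η > 0, ∀ᶠ k in atTop, V (k + 1) ≤ (1 - h k) * V k + h k * η) :
    Tendsto V atTop (𝓝 0) := by
  rw [Metric.tendsto_atTop']
  intro ε hε
  have hη : 0 < ε / 2 := by positivity
  obtain ⟨N, hN⟩ := eventually_atTop.1 (h1.and (hrec _ hη))
  -- The excess over `ε / 2` contracts without an error term, so it decays at least as fast as `s`.
  have key : ∀ k, N ≤ k → max (V k - ε / 2) 0 ≤ s k * (max (V N - ε / 2) 0 / s N) := by
    intro k hk
    induction k, hk using Nat.le_induction with
    | base =>
      rw [mul_div_cancel₀ _ (hs N).ne']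
    | succ k hk ih =>
      obtain ⟨⟨ha, hb⟩, hc⟩ := hN k hk
      have hnn : 0 ≤ max (V N - ε / 2) 0 / s N := div_nonneg (le_max_right _ _) (hs N).le
      refine max_le ?_ (mul_nonneg (hs _).le hnn)
      calc V (k + 1) - ε / 2 ≤ (1 - h k) * (V k - ε / 2) := by linarith
        _ ≤ (1 - h k) * max (V k - ε / 2) 0 := mul_le_mul_of_nonneg_left (le_max_left _ _) ha
        _ ≤ s (k + 1) / s k * max (V k - ε / 2) 0 :=
          mul_le_mul_of_nonneg_right hb (le_max_right _ _)
        _ ≤ s (k + 1) / s k * (s k * (max (V N - ε / 2) 0 / s N)) :=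
          mul_le_mul_of_nonneg_left ih (div_nonneg (hs _).le (hs _).le)
        _ = _ := by
          have := (hs k).ne'
          field_simp
  have hlim : Tendsto (fun k => s k * (max (V N - ε / 2) 0 / s N)) atTop (𝓝 0) := by
    simpa using hs0.mul_const (max (V N - ε / 2) 0 / s N)
  obtain ⟨N', hN'⟩ := eventually_atTop.1 (hlim.eventually_lt_const hη)
  refine ⟨max N N', fun k hk => ?_⟩
  have hk1 := key k ((le_max_left _ _).trans hk.le)
  have hk2 := hN' k ((le_max_right _ _).trans hk.le)
  rw [Real.dist_eq, sub_zero, abs_of_nonneg (hV k)]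
  linarith [le_max_left (V k - ε / 2) 0]

end Recursion

/-! ### Almost sure convergence of the accumulated noise. -/

section Noise

/-- Kolmogorov's one-series theorem: independent centred square-integrable random variables with
summable variances have an almost surely convergent series. -/
theorem ae_exists_tendsto_sum {Ω : Type*} [MeasurableSpace Ω] {P : Measure Ω}
    [IsProbabilityMeasure P] {X : ℕ → Ω → ℝ} (hX : ∀ k, Measurable (X k)) (hind : iIndepFun X P)
    (hL2 : ∀ k, MemLp (X k) 2 P) (hmean : ∀ k, ∫ ω, X k ω ∂P = 0)
    (hvar : Summable fun k => Var[X k; P]) :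
    ∀ᵐ ω ∂P, ∃ c, Tendsto (fun n => ∑ k ∈ Finset.range n, X k ω) atTop (𝓝 c) := by
  -- The range `n + 1` makes `S n` use exactly `X 0, …, X n`, hence adapted to the natural
  -- filtration at time `n`.
  let S : ℕ → Ω → ℝ := fun n => ∑ k ∈ Finset.range (n + 1), X k
  let ℱ := Filtration.natural X fun k => (hX k).stronglyMeasurable
  have hS2 : ∀ n, MemLp (S n) 2 P := fun n => memLp_finsetSum' _ fun k _ => hL2 k
  have hS1 : ∀ n, Integrable (S n) P := fun n => (hS2 n).integrable one_le_two
  have hmart : Martingale S ℱ P := by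
    refine martingale_of_condExp_sub_eq_zero_nat (fun n => ?_) hS1 fun n => ?_
    · exact Finset.stronglyMeasurable_sum _ fun k hk =>
        (Filtration.stronglyAdapted_natural (fun k => (hX k).stronglyMeasurable) k).mono
          (ℱ.mono (Nat.lt_succ_iff.1 (Finset.mem_range.1 hk)))
    · have h1 : S (n + 1) - S n = X (n + 1) := by
        simp only [S]
        rw [Finset.sum_range_succ _ (n + 1), add_sub_cancel_left]
      rw [h1]
      refine (hind.condExp_natural_ae_eq_of_lt (fun k => (hX k).stronglyMeasurable)
        (Nat.lt_succ_self n)).trans ?_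
      rw [hmean]
      rfl
  -- An `L¹` bound suffices for martingale convergence; it follows from the variance through `|s| ≤
  -- 1 + s ^ 2`.
  have hbound : ∀ n, eLpNorm (S n) 1 P ≤ (Real.toNNReal (1 + ∑' k, Var[X k; P]) : NNReal) := by
    intro n
    have hmeanS : ∫ ω, S n ω ∂P = 0 := by
      simp only [S, Finset.sum_apply]
      rw [integral_finsetSum _ fun k _ => (hL2 k).integrable one_le_two]
      simp [hmean]
    have hvarS : ∫ ω, S n ω ^ 2 ∂P ≤ ∑' k, Var[X k; P] := by
      rw [← variance_of_integral_eq_zero (hS1 n).aemeasurable hmeanS,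
        IndepFun.variance_sum (fun k _ => hL2 k) fun i _ j _ hij => hind.indepFun hij]
      exact hvar.sum_le_tsum _ fun k _ => variance_nonneg _ _
    rw [eLpNorm_one_eq_lintegral_enorm, ← ofReal_integral_norm_eq_lintegral_enorm (hS1 n)]
    refine ENNReal.ofReal_le_ofReal ?_
    calc ∫ ω, ‖S n ω‖ ∂P ≤ ∫ ω, (1 + S n ω ^ 2) ∂P := by
          refine integral_mono (hS1 n).norm ((integrable_const _).add (hS2 n).integrable_sq)
            fun ω => ?_
          simp only [Real.norm_eq_abs]
          nlinarith [sq_nonneg (|S n ω| - 1), sq_abs (S n ω)]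
      _ = 1 + ∫ ω, S n ω ^ 2 ∂P := by
          rw [integral_add (integrable_const _) (hS2 n).integrable_sq]
          simp
      _ ≤ _ := by linarith
  filter_upwards [hmart.submartingale.exists_ae_tendsto_of_bdd hbound] with ω hω
  obtain ⟨c, hc⟩ := hω
  refine ⟨c, (tendsto_add_atTop_iff_nat 1).1 ?_⟩
  simpa [S] using hc

/-- A series of independent Gaussian vectors with square-summable scales converges almost surely. -/
theorem ae_exists_tendsto_sum_smul_stdGaussian {d : ℕ} {Ω : Type*} [MeasurableSpace Ω]
    {P : Measure Ω} [IsProbabilityMeasure P] {Z : ℕ → Ω → EuclideanSpace ℝ (Fin d)}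
    (hZ : ∀ k, HasLaw (Z k) (stdGaussian (EuclideanSpace ℝ (Fin d))) P) (hind : iIndepFun Z P)
    {a : ℕ → ℝ} (ha : Summable fun k => a k ^ 2) :
    ∀ᵐ ω ∂P, ∃ N, Tendsto (fun n => ∑ k ∈ Finset.range n, a k • Z k ω) atTop (𝓝 N) := by
  -- `HasLaw` gives only almost everywhere measurability, while the natural filtration needs
  -- measurable versions.
  let Y : ℕ → Ω → EuclideanSpace ℝ (Fin d) := fun k => (hZ k).aemeasurable.mk (Z k)
  have hZY : ∀ k, Z k =ᵐ[P] Y k := fun k => (hZ k).aemeasurable.ae_eq_mk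
  have hYm : ∀ k, Measurable (Y k) := fun k => (hZ k).aemeasurable.measurable_mk
  have hY : ∀ k, HasLaw (Y k) (stdGaussian (EuclideanSpace ℝ (Fin d))) P := fun k =>
    (hZ k).congr (hZY k).symm
  have hYind : iIndepFun Y P := hind.congr hZY
  have hcoord : ∀ i : Fin d, ∀ᵐ ω ∂P, ∃ c,
      Tendsto (fun n => ∑ k ∈ Finset.range n, a k * Y k ω i) atTop (𝓝 c) := by
    intro i
    let L : StrongDual ℝ (EuclideanSpace ℝ (Fin d)) := EuclideanSpace.proj i
    have hL : ∀ k, HasLaw (fun ω => L (Y k ω))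
        ((stdGaussian (EuclideanSpace ℝ (Fin d))).map L) P := fun k =>
      ⟨(L.continuous.measurable.comp (hYm k)).aemeasurable, by
        rw [← (hY k).map_eq, Measure.map_map L.continuous.measurable (hYm k)]
        rfl⟩
    have hmem : ∀ k, MemLp (fun ω => L (Y k ω)) 2 P := fun k => by
      have h := IsGaussian.memLp_dual (stdGaussian (EuclideanSpace ℝ (Fin d))) L 2 (by simp)
      rw [← (hY k).map_eq] at h
      exact h.comp_of_map (hYm k).aemeasurable
    refine ae_exists_tendsto_sum (X := fun k ω => a k * L (Y k ω))
      (fun k => (L.continuous.measurable.comp (hYm k)).const_mul _)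
      (hYind.comp (fun k v => a k * L v) fun k => L.continuous.measurable.const_mul _)
      (fun k => (hmem k).const_mul _) (fun k => ?_) ?_
    · rw [integral_const_mul]
      have h := (hY k).integral_comp (f := L) L.continuous.aestronglyMeasurable
      rw [integral_strongDual_stdGaussian] at h
      simp only [Function.comp_def] at h
      rw [h, mul_zero]
    · have hv : ∀ k, Var[fun ω => a k * L (Y k ω); P] = a k ^ 2 * ‖L‖ ^ 2 := fun k => by
        rw [variance_const_mul, ← variance_dual_stdGaussian, ← (hY k).map_eq,
          variance_map L.continuous.aemeasurable (hYm k).aemeasurable]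
        rfl
      simp_rw [hv]
      exact ha.mul_right _
  filter_upwards [ae_all_iff.2 hZY, ae_all_iff.2 hcoord] with ω h1 h2
  choose c hc using h2
  refine ⟨WithLp.toLp 2 c, ?_⟩
  simp_rw [h1]
  have h := ((PiLp.continuous_toLp 2 fun _ : Fin d => ℝ).tendsto c).comp (tendsto_pi_nhds.2 hc)
  refine h.congr fun n => ?_
  ext i
  simp

end Noise

/-! ### One-step contraction estimate. -/

section Step

/-- One step of the perturbed contraction toward a point `q`. -/
theorem norm_sq_step_le {E : Type*} [NormedAddCommGroup E] [InnerProductSpace ℝ E]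
    {x y q m₀ m e : E} {γ h a b β : ℝ} (hγ : 1 ≤ γ) (hh : 0 ≤ h)
    (hAh : 4 * (2 * γ - 1) ^ 2 * h ≤ 1)
    (hm₀ : inner ℝ (m₀ - q) (y - q) ≤ 0) (hyx : ‖y - x‖ ≤ a)
    (hxm₀ : ‖x - m₀‖ ≤ ‖y - q‖ + a) (hxm : ‖x - m‖ ≤ ‖y - q‖ + a)
    (he : ‖e‖ ≤ b * (1 + ‖y - q‖)) (hβ : (2 * γ - 1) * a + b ≤ β) (hβ' : β ≤ 1 / 16) :
    ‖y + h • (m₀ + (γ - 1) • (m₀ - m) - x + e) - q‖ ^ 2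
      ≤ (1 - h) * ‖y - q‖ ^ 2 + h * (3 * β) := by
  set v := y - q with hv
  set ρ := ‖v‖ with hρ
  have hρ0 : 0 ≤ ρ := norm_nonneg _
  have ha : 0 ≤ a := (norm_nonneg _).trans hyx
  have hb : 0 ≤ b := by
    by_contra! hb
    nlinarith [norm_nonneg e]
  have hβ0 : 0 ≤ β := le_trans (by nlinarith) hβ
  set g := m₀ + (γ - 1) • (m₀ - m) - x + e with hg
  have i1 : inner ℝ (y - x) v ≤ a * ρ :=
    (real_inner_le_norm _ _).trans (mul_le_mul_of_nonneg_right hyx hρ0)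
  have i2 : inner ℝ (x - m) v ≤ (ρ + a) * ρ :=
    (real_inner_le_norm _ _).trans (mul_le_mul_of_nonneg_right hxm hρ0)
  have i3 : inner ℝ e v ≤ b * (1 + ρ) * ρ :=
    (real_inner_le_norm _ _).trans (mul_le_mul_of_nonneg_right he hρ0)
  have i4 : inner ℝ v v = ρ ^ 2 := real_inner_self_eq_norm_sq v
  have hgv : inner ℝ g v ≤ -ρ ^ 2 + β * (1 + 2 * ρ ^ 2) := by
    have e1 : g = ((m₀ - q) - v + (y - x)) +
        (γ - 1) • ((m₀ - q) - v + (y - x) + (x - m)) + e := by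
      rw [hg, hv]
      have e2 : m₀ - q - (y - q) + (y - x) + (x - m) = m₀ - m := by abel
      have e3 : m₀ - q - (y - q) + (y - x) = m₀ - x := by abel
      rw [e2, e3]
      abel
    rw [e1]
    simp only [inner_add_left, inner_sub_left (m₀ - q), inner_smul_left, conj_trivial]
    rw [i4]
    -- This bounds `⟨m₀ - m, v⟩`: the gain `-ρ ^ 2` cancels the leading part of `⟨x - m, v⟩ ≤ (ρ +
    -- a) * ρ`.
    have j1 : inner ℝ (m₀ - q) v - ρ ^ 2 + inner ℝ (y - x) v + inner ℝ (x - m) v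
        ≤ 2 * a * ρ := by nlinarith
    have j2 := mul_le_mul_of_nonneg_left j1 (sub_nonneg.2 hγ)
    have j3 : ((2 * γ - 1) * a + b) * (ρ + ρ ^ 2) ≤ β * (ρ + ρ ^ 2) :=
      mul_le_mul_of_nonneg_right hβ (by positivity)
    have j4 : β * (ρ + ρ ^ 2) ≤ β * (1 + 2 * ρ ^ 2) :=
      mul_le_mul_of_nonneg_left (by nlinarith [sq_nonneg (ρ - 1)]) hβ0
    have j5 : 0 ≤ (2 * γ - 1) * a * ρ ^ 2 :=
      mul_nonneg (mul_nonneg (by linarith) ha) (sq_nonneg _)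
    nlinarith
  have hgn : ‖g‖ ≤ (2 * γ - 1) * ρ + β * (1 + ρ) := by
    have e1 : g = -(x - m₀) + (γ - 1) • (-(x - m₀) + (x - m)) + e := by
      rw [hg]
      have e2 : -(x - m₀) + (x - m) = m₀ - m := by abel
      rw [e2]
      abel
    have n1 : ‖(γ - 1) • (-(x - m₀) + (x - m))‖ ≤ (γ - 1) * ((ρ + a) + (ρ + a)) := by
      rw [norm_smul, Real.norm_of_nonneg (by linarith)]
      refine mul_le_mul_of_nonneg_left ((norm_add_le _ _).trans ?_) (by linarith)
      rw [norm_neg]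
      exact add_le_add hxm₀ hxm
    have n2 := norm_add₃_le (a := -(x - m₀)) (b := (γ - 1) • (-(x - m₀) + (x - m))) (c := e)
    rw [norm_neg, ← e1] at n2
    have j3 : ((2 * γ - 1) * a + b) * (1 + ρ) ≤ β * (1 + ρ) :=
      mul_le_mul_of_nonneg_right hβ (by positivity)
    have j5 : 0 ≤ (2 * γ - 1) * a * ρ := mul_nonneg (mul_nonneg (by linarith) ha) hρ0
    nlinarith
  have hgn2 : ‖g‖ ^ 2 ≤ 2 * (2 * γ - 1) ^ 2 * ρ ^ 2 + 4 * β ^ 2 * (1 + ρ ^ 2) := by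
    have k1 : ‖g‖ ^ 2 ≤ ((2 * γ - 1) * ρ + β * (1 + ρ)) ^ 2 :=
      pow_le_pow_left₀ (norm_nonneg _) hgn 2
    nlinarith [sq_nonneg ((2 * γ - 1) * ρ - β * (1 + ρ)), mul_nonneg (sq_nonneg β)
      (sq_nonneg (1 - ρ))]
  have e1 : y + h • g - q = v + h • g := by rw [hv]; abel
  rw [e1, norm_add_sq_real, inner_smul_right, real_inner_comm, norm_smul,
    Real.norm_of_nonneg hh, mul_pow]
  have h4 : 4 * h ≤ 1 := by
    have : 1 ≤ (2 * γ - 1) ^ 2 := one_le_pow₀ (by linarith)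
    nlinarith [mul_le_mul_of_nonneg_right this hh]
  -- One factor `h` is spent on `4 * (2 * γ - 1) ^ 2 * h ≤ 1`, leaving `h * ρ ^ 2 / 2` against the
  -- drift `-2 * h * ρ ^ 2`.
  have l1 : h ^ 2 * ‖g‖ ^ 2 ≤ h * (ρ ^ 2 / 2 + β ^ 2 * (1 + ρ ^ 2)) := by
    calc h ^ 2 * ‖g‖ ^ 2
        ≤ h ^ 2 * (2 * (2 * γ - 1) ^ 2 * ρ ^ 2 + 4 * β ^ 2 * (1 + ρ ^ 2)) :=
          mul_le_mul_of_nonneg_left hgn2 (sq_nonneg _)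
      _ = h * ((4 * (2 * γ - 1) ^ 2 * h) * (ρ ^ 2 / 2) + (4 * h) * (β ^ 2 * (1 + ρ ^ 2))) := by
          ring
      _ ≤ h * (1 * (ρ ^ 2 / 2) + 1 * (β ^ 2 * (1 + ρ ^ 2))) := by gcongr
      _ = _ := by ring
  have l2 : h * inner ℝ g v ≤ h * (-ρ ^ 2 + β * (1 + 2 * ρ ^ 2)) :=
    mul_le_mul_of_nonneg_left hgv hh
  have l3 : β ^ 2 ≤ β / 16 := by
    have := mul_le_mul_of_nonneg_right hβ' hβ0
    rw [sq]
    linarith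
  have l4 : h * (β ^ 2 * (1 + ρ ^ 2)) ≤ h * (β / 16 * (1 + ρ ^ 2)) := by gcongr
  have l5 : h * (β * ρ ^ 2) ≤ h * (1 / 16 * ρ ^ 2) := by gcongr
  have l6 : 0 ≤ h * β := mul_nonneg hh hβ0
  have l7 : 0 ≤ h * ρ ^ 2 := by positivity
  linarith

end Step

/-! ### The guided score in terms of posterior means. -/

section Score

variable {d : ℕ} {I : Type*} [Fintype I] {M : MixtureData d I} {η₀ : I}

theorem MixtureData.IsAdmissible.exists_isBoundedDensity (hM : M.IsAdmissible η₀) :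
    ∃ R : ℝ, 0 ≤ R ∧ (∀ η, IsBoundedDensity (M.p η) R) ∧ IsBoundedDensity M.p0 R := by
  have hbdd : Bornology.IsBounded (⋃ η, M.K η) :=
    Bornology.isBounded_iUnion.2 fun η => (hM.K_compact η).isBounded
  obtain ⟨R, hR0, hR⟩ := hbdd.exists_pos_norm_le
  have hp : ∀ η, IsBoundedDensity (M.p η) R := fun η =>
    { nonneg := hM.p_nonneg η
      integrable := by
        -- The integral of a non-integrable function is `0` by convention, which contradicts total
        -- mass `1`.
        by_contra h
        have := hM.integral_p η
        rw [integral_undef h] at this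
        exact zero_ne_one this
      support := fun x hx => hM.p_support η x fun hxK =>
        hx.not_ge (hR x (Set.mem_iUnion.2 ⟨η, hxK⟩)) }
  refine ⟨R, hR0.le, hp, ⟨fun x => ?_, ?_, fun x hx => ?_⟩⟩
  · exact Finset.sum_nonneg fun η _ => mul_nonneg (hM.w_nonneg η) (hM.p_nonneg η x)
  · exact integrable_finsetSum _ fun η _ => (hp η).integrable.const_mul _
  · exact Finset.sum_eq_zero fun η _ => by rw [(hp η).support x hx, mul_zero]

theorem MixtureData.IsAdmissible.mul_le_p0 (hM : M.IsAdmissible η₀)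
    (x : EuclideanSpace ℝ (Fin d)) : M.w η₀ * M.p η₀ x ≤ M.p0 x :=
  Finset.single_le_sum (f := fun η => M.w η * M.p η x)
    (fun η _ => mul_nonneg (hM.w_nonneg η) (hM.p_nonneg η x)) (Finset.mem_univ η₀)

/-- The weight of the label adds only a constant to the log posterior, so Tweedie's formula for the
component and for the mixture gives everything. -/
theorem MixtureData.guidedScore_eq (hM : M.IsAdmissible η₀) {R : ℝ}
    (hp : IsBoundedDensity (M.p η₀) R) (hp0 : IsBoundedDensity M.p0 R) (γ : ℝ) {t : ℝ}
    (ht : 0 < t) (hpos : ∀ x, 0 < heat (M.p η₀) t x) (hpos0 : ∀ x, 0 < heat M.p0 t x)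
    (x : EuclideanSpace ℝ (Fin d)) :
    M.guidedScore η₀ γ t x = (sig t ^ 2)⁻¹ • (lam t • (postMean (M.p η₀) t x
      + (γ - 1) • (postMean (M.p η₀) t x - postMean M.p0 t x)) - x) := by
  have h1 : HasGradientAt (fun y => Real.log (M.marginal t y))
      ((sig t ^ 2)⁻¹ • (lam t • postMean M.p0 t x - x)) x := hp0.gradient_log_heat ht (hpos0 x)
  have h2 := hp.gradient_log_heat ht (hpos x)
  have hlog : (fun y => Real.log (M.posterior t η₀ y)) = fun y =>
      Real.log (heat (M.p η₀) t y) - Real.log (heat M.p0 t y) + Real.log (M.w η₀) := by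
    funext y
    change Real.log (M.w η₀ * heat (M.p η₀) t y / heat M.p0 t y) = _
    rw [Real.log_div (mul_pos hM.w_target_pos (hpos y)).ne' (hpos0 y).ne',
      Real.log_mul hM.w_target_pos.ne' (hpos y).ne']
    ring
  have h3 : HasGradientAt (fun y => Real.log (M.posterior t η₀ y))
      ((sig t ^ 2)⁻¹ • (lam t • postMean (M.p η₀) t x - x)
        - (sig t ^ 2)⁻¹ • (lam t • postMean M.p0 t x - x)) x := by
    rw [hlog, hasGradientAt_iff_hasFDerivAt, map_sub]
    exact (h2.hasFDerivAt.sub h1.hasFDerivAt).add_const _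
  rw [guidedScore, h1.gradient, h3.gradient]
  module

end Score

/-! ### Effective step sizes and summability of the noise scales. -/

section StepSize

/-- The effective step size of the exponential integrator, as a fraction of the pull toward the
posterior mean. -/
noncomputable def effStep (Δ s : ℝ) : ℝ := 2 * (Real.exp Δ - 1) / sig s ^ 2

/-- Uses `Δ ≤ e^Δ - 1` and `σ_s² ≤ 2 s`. With `s` the remaining time, it gives the telescoping bound
`1 - h k ≤ s (k + 1) / s k`. -/
theorem div_le_effStep {Δ s : ℝ} (hΔ : 0 ≤ Δ) (hs : 0 < s) : Δ / s ≤ effStep Δ s := by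
  have hσ : 0 < sig s ^ 2 := by
    have := sig_pos hs
    positivity
  have h1 : Δ ≤ Real.exp Δ - 1 := by linarith [Real.add_one_le_exp Δ]
  have h2 : sig s ^ 2 ≤ 2 * s := by
    rw [sig_sq hs, lam, ← Real.exp_nat_mul]
    have := Real.add_one_le_exp (((2 : ℕ) : ℝ) * -s)
    push_cast at this ⊢
    linarith
  rw [effStep, div_le_div_iff₀ hs hσ]
  calc Δ * sig s ^ 2 ≤ (Real.exp Δ - 1) * (2 * s) := by gcongr; linarith
    _ = _ := by ring

theorem exp_sub_one_le {x : ℝ} : Real.exp x - 1 ≤ x * Real.exp x := by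
  have h1 := Real.add_one_le_exp (-x)
  have h2 : Real.exp (-x) * Real.exp x = 1 := by rw [← Real.exp_add]; simp
  nlinarith [Real.exp_pos x]

theorem effStep_le {Δ s : ℝ} (hΔ : 0 ≤ Δ) (hΔ' : Δ ≤ 1 / 2) (hs : 0 < s) (hs' : s ≤ 1 / 2) :
    effStep Δ s ≤ 4 * (Δ / s) := by
  have hσ : 0 < sig s ^ 2 := by
    have := sig_pos hs
    positivity
  have h1 : Real.exp Δ - 1 ≤ 2 * Δ := by
    have := exp_sub_one_le (x := Δ)
    nlinarith
  have h2 : s ≤ sig s ^ 2 := by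
    rw [sig_sq hs, lam, ← Real.exp_nat_mul]
    have h3 := Real.add_one_le_exp (2 * s)
    have h4 : Real.exp (((2 : ℕ) : ℝ) * -s) * Real.exp (2 * s) = 1 := by
      rw [← Real.exp_add]; simp
    nlinarith [Real.exp_pos (((2 : ℕ) : ℝ) * -s)]
  rw [effStep, mul_div_assoc', div_le_div_iff₀ hσ hs]
  nlinarith [mul_le_mul_of_nonneg_left h2 hΔ, mul_le_mul_of_nonneg_right h1 hs.le]

variable {κ T : ℝ} {t : ℕ → ℝ}

theorem IsTimeGrid.tendsto_sub (ht : IsTimeGrid T t) :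
    Tendsto (fun k => T - t k) atTop (𝓝[>] 0) := by
  refine tendsto_nhdsWithin_iff.2 ⟨?_, Eventually.of_forall fun k => ?_⟩
  · simpa using ht.tendsto.const_sub T
  · exact sub_pos.2 (ht.lt_end k)

/-- The squared noise scales of the exponential integrator are summable. -/
theorem IsTimeGrid.summable_noise (ht : IsTimeGrid T t) (hstep : StepSizeBound κ T t)
    (hκ : 0 ≤ κ) (hκ1 : κ ≤ 1) :
    Summable fun k => Real.sqrt (Real.exp (2 * (t (k + 1) - t k)) - 1) ^ 2 := by
  have hΔ0 : ∀ k, 0 ≤ t (k + 1) - t k := fun k => sub_nonneg.2 (ht.lt_succ k).le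
  have hΔ1 : ∀ k, t (k + 1) - t k ≤ 1 := fun k =>
    (hstep k).trans ((mul_le_mul_of_nonneg_left (min_le_left _ _) hκ).trans (by linarith))
  have hsum : Summable fun k => t (k + 1) - t k := by
    refine summable_of_sum_range_le (c := T) hΔ0 fun n => ?_
    rw [Finset.sum_range_sub, ht.zero, sub_zero]
    exact (ht.lt_end n).le
  refine Summable.of_nonneg_of_le (fun k => sq_nonneg _) (fun k => ?_)
    (hsum.mul_right (2 * Real.exp 2))
  have h1 : 1 ≤ Real.exp (2 * (t (k + 1) - t k)) := Real.one_le_exp (by linarith [hΔ0 k])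
  rw [Real.sq_sqrt (by linarith)]
  refine exp_sub_one_le.trans ?_
  have h2 : Real.exp (2 * (t (k + 1) - t k)) ≤ Real.exp 2 :=
    Real.exp_le_exp.2 (by linarith [hΔ1 k])
  nlinarith [mul_le_mul_of_nonneg_left h2 (hΔ0 k)]

/-- Eventually, the effective steps are at most `4 κ`. -/
theorem IsTimeGrid.eventually_effStep_le (ht : IsTimeGrid T t) (hstep : StepSizeBound κ T t)
    (hκ : 0 ≤ κ) (hκ1 : κ ≤ 1 / 2) :
    ∀ᶠ k in atTop, effStep (t (k + 1) - t k) (T - t k) ≤ 4 * κ := by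
  have h := (ht.tendsto_sub.mono_right nhdsWithin_le_nhds).eventually_le_const
    (show (0 : ℝ) < 1 / 2 by norm_num)
  filter_upwards [h] with k hk
  have hs : 0 < T - t k := sub_pos.2 (ht.lt_end k)
  have hlt := ht.lt_succ k
  have h1 : t (k + 1) - t k ≤ κ * (T - t (k + 1)) :=
    (hstep k).trans (mul_le_mul_of_nonneg_left (min_le_right _ _) hκ)
  have h2 : t (k + 1) - t k ≤ κ * 1 :=
    (hstep k).trans (mul_le_mul_of_nonneg_left (min_le_left _ _) hκ)
  refine (effStep_le (by linarith) (by linarith) hs hk).trans ?_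
  refine mul_le_mul_of_nonneg_left ?_ (by norm_num)
  rw [div_le_iff₀ hs]
  exact h1.trans (mul_le_mul_of_nonneg_left (by linarith) hκ)

end StepSize

/-! ### Pathwise convergence and the main theorem. -/

section Convergence

variable {d : ℕ} {I : Type*} [Fintype I] {M : MixtureData d I} {η₀ : I}

/-- Pathwise convergence: along every noise sequence whose accumulated noise converges, the
iterates approach the target set. -/
theorem MixtureData.IsAdmissible.tendsto_infDist_ddpm (hM : M.IsAdmissible η₀) {γ T κ : ℝ}
    (hγ : 1 ≤ γ) (hκ : 0 < κ) (hκγ : 16 * (2 * γ - 1) ^ 2 * κ ≤ 1) {t : ℕ → ℝ}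
    (ht : IsTimeGrid T t) (hstep : StepSizeBound κ T t) (x₀ : EuclideanSpace ℝ (Fin d))
    {z : ℕ → EuclideanSpace ℝ (Fin d)} {N : EuclideanSpace ℝ (Fin d)}
    (hN : Tendsto (fun n => ∑ k ∈ Finset.range n,
      Real.sqrt (Real.exp (2 * (t (k + 1) - t k)) - 1) • z k) atTop (𝓝 N)) :
    Tendsto (fun k => Metric.infDist (M.ddpm η₀ γ T t x₀ z k) (M.K η₀)) atTop (𝓝 0) := by
  obtain ⟨R, hR, hpη, hp0⟩ := hM.exists_isBoundedDensity
  have hp := hpη η₀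
  obtain ⟨c, hc, hcK⟩ := hM.p_target_lower
  have hw := hM.w_target_pos
  have hcK0 : ∀ u ∈ M.K η₀, M.w η₀ * c ≤ M.p0 u := fun u hu =>
    (mul_le_mul_of_nonneg_left (hcK u hu) hw.le).trans (hM.mul_le_p0 u)
  have hconv := hM.K_convex η₀
  have hcomp := hM.K_compact η₀
  have hint := hM.K_interior η₀
  have hne : (M.K η₀).Nonempty := hint.mono interior_subset
  have hKR : ∀ u ∈ M.K η₀, ‖u‖ ≤ R := fun u hu => by
    by_contra! h
    linarith [hcK u hu, hp.support u h]
  have hγ2 : 1 ≤ (2 * γ - 1) ^ 2 := one_le_pow₀ (by linarith)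
  have hκ16 : κ ≤ 1 / 16 := by nlinarith [mul_le_mul_of_nonneg_right hγ2 hκ.le]
  set x := M.ddpm η₀ γ T t x₀ z with hx
  set S : ℕ → EuclideanSpace ℝ (Fin d) := fun n => ∑ k ∈ Finset.range n,
      Real.sqrt (Real.exp (2 * (t (k + 1) - t k)) - 1) • z k with hS
  -- Adding the noise still to come cancels the increment of each step.
  set y : ℕ → EuclideanSpace ℝ (Fin d) := fun k => x k + (N - S k) with hy
  set s : ℕ → ℝ := fun k => T - t k with hs
  set h : ℕ → ℝ := fun k => effStep (t (k + 1) - t k) (s k) with hh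
  have hspos : ∀ k, 0 < s k := fun k => sub_pos.2 (ht.lt_end k)
  have hs0 : Tendsto s atTop (𝓝[>] 0) := ht.tendsto_sub
  have hΔ : ∀ k, 0 < t (k + 1) - t k := fun k => sub_pos.2 (ht.lt_succ k)
  have hhlow : ∀ k, (t (k + 1) - t k) / s k ≤ h k := fun k => div_le_effStep (hΔ k).le (hspos k)
  have hhnn : ∀ k, 0 ≤ h k := fun k => (div_nonneg (hΔ k).le (hspos k).le).trans (hhlow k)
  have hhup : ∀ᶠ k in atTop, h k ≤ 4 * κ :=
    ht.eventually_effStep_le hstep hκ.le (by linarith)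
  have hyx : ∀ k, y k - x k = N - S k := fun k => add_sub_cancel_left _ _
  have hr : Tendsto (fun k => ‖y k - x k‖) atTop (𝓝 0) := by
    simp_rw [hyx]
    simpa using (hN.const_sub N).norm
  set m₀ : ℕ → EuclideanSpace ℝ (Fin d) := fun k => postMean (M.p η₀) (s k) (x k) with hm₀
  set m : ℕ → EuclideanSpace ℝ (Fin d) := fun k => postMean M.p0 (s k) (x k) with hm
  set D : ℕ → EuclideanSpace ℝ (Fin d) := fun k => m₀ k + (γ - 1) • (m₀ k - m k) with hD
  set e : ℕ → EuclideanSpace ℝ (Fin d) := fun k =>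
    (lam (s k) - 1) • D k + (sig (s k) ^ 2 / 2) • x k with he
  have hpos : ∀ k x, 0 < heat (M.p η₀) (s k) x := fun k => hp.heat_pos (hspos k) hint hc hcK
  have hpos0 : ∀ k x, 0 < heat M.p0 (s k) x := fun k =>
    hp0.heat_pos (hspos k) hint (mul_pos hw hc) hcK0
  have hrec : ∀ k, y (k + 1) = y k + h k • (m₀ k + (γ - 1) • (m₀ k - m k) - x k + e k) := by
    intro k
    have hσ : sig (s k) ≠ 0 := (sig_pos (hspos k)).ne'
    have h1 : x (k + 1) = Real.exp (t (k + 1) - t k) • x k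
        + (2 * (Real.exp (t (k + 1) - t k) - 1)) • M.guidedScore η₀ γ (s k) (x k)
        + Real.sqrt (Real.exp (2 * (t (k + 1) - t k)) - 1) • z k := rfl
    have h2 : S (k + 1) = S k + Real.sqrt (Real.exp (2 * (t (k + 1) - t k)) - 1) • z k :=
      Finset.sum_range_succ _ _
    have h3 : (2 * (Real.exp (t (k + 1) - t k) - 1)) • M.guidedScore η₀ γ (s k) (x k)
        = h k • (lam (s k) • D k - x k) := by
      rw [M.guidedScore_eq hM hp hp0 γ (hspos k) (hpos k) (hpos0 k), smul_smul]
      rfl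
    -- The expansion factor acting on `x k` becomes the part `(sig (s k) ^ 2 / 2) • x k` of `e k`.
    have h4 : Real.exp (t (k + 1) - t k) = 1 + h k * (sig (s k) ^ 2 / 2) := by
      simp only [hh, effStep]
      field_simp
      ring
    have h5 : y (k + 1) = x (k + 1) + (N - S (k + 1)) := rfl
    have h6 : y k = x k + (N - S k) := rfl
    rw [h5, h6, h1, h2, h3, h4]
    change _ = x k + (N - S k) + h k • (D k - x k +
      ((lam (s k) - 1) • D k + (sig (s k) ^ 2 / 2) • x k))
    module
  choose q hqK hq using fun k => hcomp.exists_infDist_eq_dist hne (y k)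
  simp_rw [dist_eq_norm] at hq
  have hproj : ∀ k, ∀ u ∈ M.K η₀, inner ℝ (u - q k) (y k - q k) ≤ 0 := by
    intro k u hu
    have : ‖y k - q k‖ = ⨅ w : M.K η₀, ‖y k - w‖ := by
      rw [← hq, Metric.infDist_eq_iInf]
      simp_rw [dist_eq_norm]
    rw [real_inner_comm]
    exact (norm_eq_iInf_iff_real_inner_le_zero hconv (hqK k)).1 this u hu
  have hxy : ∀ k, Metric.infDist (x k) (M.K η₀) ≤ ‖y k - q k‖ + ‖y k - x k‖ := fun k => by
    rw [← hq, ← dist_eq_norm, dist_comm]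
    exact Metric.infDist_le_infDist_add_dist
  have hmR : ∀ k, ‖m₀ k‖ ≤ R ∧ ‖m k‖ ≤ R := fun k =>
    ⟨hp.norm_postMean_le (hspos k) (hpos k _), hp0.norm_postMean_le (hspos k) (hpos0 k _)⟩
  have hinner : ∀ k, inner ℝ (m₀ k - q k) (y k - q k) ≤ 0 := fun k => by
    rw [inner_sub_left, sub_nonpos]
    refine hp.inner_postMean_le (hspos k) (hpos k _) fun u hu => ?_
    have huK : u ∈ M.K η₀ := by
      by_contra huK
      exact hu (hM.p_support η₀ u huK)
    have := hproj k u huK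
    rwa [inner_sub_left, sub_nonpos] at this
  set b : ℕ → ℝ := fun k =>
    (1 - lam (s k)) * ((2 * γ - 1) * R) + sig (s k) ^ 2 / 2 * (2 + R) with hb
  have hb0 : Tendsto b atTop (𝓝 0) := by
    have h1 := ((tendsto_lam.comp hs0).const_sub 1).mul_const ((2 * γ - 1) * R)
    have h2 := (((tendsto_sig_sq.mono_right nhdsWithin_le_nhds).comp hs0).div_const 2).mul_const
      (2 + R)
    simpa [Function.comp_def] using h1.add h2
  have heb : ∀ k, ‖y k - x k‖ ≤ 1 → ‖e k‖ ≤ b k * (1 + ‖y k - q k‖) := by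
    intro k hk
    have hl := lam_le_one (hspos k)
    have hDk : ‖D k‖ ≤ (2 * γ - 1) * R := by
      refine (norm_add_le _ _).trans ?_
      rw [norm_smul, Real.norm_of_nonneg (by linarith)]
      have := mul_le_mul_of_nonneg_left
        ((norm_sub_le (m₀ k) (m k)).trans (add_le_add (hmR k).1 (hmR k).2)) (sub_nonneg.2 hγ)
      linarith [(hmR k).1]
    have hxk : ‖x k‖ ≤ (2 + R) * (1 + ‖y k - q k‖) := by
      have h1 : x k = -(y k - x k) + (y k - q k) + q k := by abel
      have h2 := norm_add₃_le (a := -(y k - x k)) (b := y k - q k) (c := q k)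
      rw [← h1, norm_neg] at h2
      nlinarith [hKR _ (hqK k), norm_nonneg (y k - q k)]
    refine (norm_add_le _ _).trans ?_
    rw [norm_smul, norm_smul, Real.norm_of_nonpos (by linarith),
      Real.norm_of_nonneg (by positivity)]
    have h1 : -(lam (s k) - 1) * ‖D k‖
        ≤ (1 - lam (s k)) * ((2 * γ - 1) * R) * (1 + ‖y k - q k‖) := by
      rw [neg_sub]
      have h0 : 0 ≤ (1 - lam (s k)) * ((2 * γ - 1) * R) :=
        mul_nonneg (by linarith) (mul_nonneg (by linarith) hR)
      have := mul_le_mul_of_nonneg_left hDk (sub_nonneg.2 hl)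
      nlinarith [mul_nonneg h0 (norm_nonneg (y k - q k))]
    have h2 : sig (s k) ^ 2 / 2 * ‖x k‖
        ≤ sig (s k) ^ 2 / 2 * (2 + R) * (1 + ‖y k - q k‖) := by
      rw [mul_assoc]
      exact mul_le_mul_of_nonneg_left hxk (by positivity)
    calc _ ≤ _ := add_le_add h1 h2
      _ = _ := by simp only [hb]; ring
  have hV : Tendsto (fun k => ‖y k - q k‖ ^ 2) atTop (𝓝 0) := by
    refine tendsto_zero_of_recursion (h := h) (fun k => sq_nonneg _) hspos
      (hs0.mono_right nhdsWithin_le_nhds) ?_ fun η hη => ?_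
    · filter_upwards [hhup] with k hk
      refine ⟨by linarith, ?_⟩
      have h1 : s (k + 1) / s k = 1 - (t (k + 1) - t k) / s k := by
        rw [eq_sub_iff_add_eq, ← add_div, div_eq_one_iff_eq (hspos k).ne']
        simp only [hs]
        ring
      rw [h1]
      linarith [hhlow k]
    · set β := min (1 / 16) (η / 3) with hβ
      have hβ0 : 0 < β := by positivity
      -- Splits the budget `β` evenly: `(2 * γ - 1) * a = β / 2`, and `b k ≤ β / 2` eventually.
      set a := β / (2 * (2 * γ - 1)) with ha
      have hA : 0 < 2 * γ - 1 := by linarith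
      have ha0 : 0 < a := by positivity
      have haβ : (2 * γ - 1) * a = β / 2 := by
        rw [ha]
        field_simp
      have c1 := hs0.eventually (hp.eventually_norm_sub_postMean_le hconv hcomp hint hc hcK
        (ε := a / 2) (by positivity))
      -- Concentration for the whole mixture, but still measured against the target set, where `p0`
      -- is at least `w η₀ * c`.
      have c2 := hs0.eventually (hp0.eventually_norm_sub_postMean_le hconv hcomp hint
        (mul_pos hw hc) hcK0 (ε := a / 2) (by positivity))
      filter_upwards [c1, c2, hhup, hr.eventually_le_const (show (0 : ℝ) < a / 2 by positivity),
        hr.eventually_le_const one_pos, hb0.eventually_le_const (show (0 : ℝ) < β / 2 by positivity)]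
        with k d1 d2 d3 d4 d5 d6
      have hstep' := norm_sq_step_le (x := x k) (y := y k) (q := q k) (m₀ := m₀ k) (m := m k)
        (e := e k) (a := a) (b := b k) (β := β) hγ (hhnn k) (by nlinarith) (hinner k)
        (by linarith) (by linarith [d1 (x k), hxy k]) (by linarith [d2 (x k), hxy k])
        (heb k d5) (by linarith) (min_le_left _ _)
      rw [← hrec] at hstep'
      have h1 : ‖y (k + 1) - q (k + 1)‖ ≤ ‖y (k + 1) - q k‖ := by
        rw [← hq, ← dist_eq_norm]
        exact Metric.infDist_le_dist_of_mem (hqK k)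
      have h2 := pow_le_pow_left₀ (norm_nonneg _) h1 2
      have h3 : h k * (3 * β) ≤ h k * η :=
        mul_le_mul_of_nonneg_left (by linarith [min_le_right (1 / 16) (η / 3)]) (hhnn k)
      linarith
  have hρ : Tendsto (fun k => ‖y k - q k‖) atTop (𝓝 0) := by
    have := hV.sqrt
    simpa [Real.sqrt_sq (norm_nonneg _)] using this
  refine squeeze_zero (fun k => Metric.infDist_nonneg) hxy ?_
  simpa using hρ.add hr

end Convergence

end GuidedDiffusion

theorem theorem4 {d : ℕ} {I : Type*} [Fintype I]
    (M : GuidedDiffusion.MixtureData d I) (η₀ : I) (hM : M.IsAdmissible η₀)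
    (γ : ℝ) (hγ : 1 ≤ γ) (T : ℝ) (hT : 0 < T) :
    ∃ κ₀ : ℝ, 0 < κ₀ ∧
      ∀ κ : ℝ, 0 < κ → κ < 1 → κ ≤ κ₀ →
      ∀ t : ℕ → ℝ, GuidedDiffusion.IsTimeGrid T t → GuidedDiffusion.StepSizeBound κ T t →
      ∀ x₀ : EuclideanSpace ℝ (Fin d),
      ∀ (Ω : Type*) [MeasurableSpace Ω] (P : Measure Ω) [IsProbabilityMeasure P]
        (Z : ℕ → Ω → EuclideanSpace ℝ (Fin d)),
        (∀ k, HasLaw (Z k) (stdGaussian (EuclideanSpace ℝ (Fin d))) P) → iIndepFun Z P →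
        ∀ᵐ ω ∂P, Tendsto
          (fun k => Metric.infDist (M.ddpm η₀ γ T t x₀ (fun j => Z j ω) k) (M.K η₀))
          atTop (𝓝 0) := by
  have hA : 0 < 16 * (2 * γ - 1) ^ 2 := by
    have : 0 < 2 * γ - 1 := by linarith
    positivity
  -- Eventually `h ≤ 4 * κ`, so this `κ₀` gives the condition `4 * (2 * γ - 1) ^ 2 * h ≤ 1` of the
  -- one-step estimate.
  refine ⟨1 / (16 * (2 * γ - 1) ^ 2), by positivity, ?_⟩
  intro κ hκ hκ1 hκ₀ t ht hstep x₀ Ω _ P _ Z hZ hind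
  filter_upwards [GuidedDiffusion.ae_exists_tendsto_sum_smul_stdGaussian hZ hind
    (ht.summable_noise hstep hκ.le hκ1.le)] with ω ⟨N, hN⟩
  refine hM.tendsto_infDist_ddpm hγ hκ ?_ ht hstep x₀ hN
  rw [le_div_iff₀ hA] at hκ₀
  linarith
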